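/- Let $p$ be a prime, let $|\cdot|_p$ and $v_p$ be the $p$-adic absolute value and valuation on $\mathbb{Q}_p$, and let $p\mathbb{Z}_p=\{x\in\mathbb{Q}_p: |x|_p<1\}$. The Schneider map $T_p:p\mathbb{Z}_p\to p\mathbb{Z}_p$ is defined by $T_p(0)=0$ and, for $x\neq 0$, $$T_p(x)=\frac{p^{a_1(x)}}{x}-b_1(x),\qquad a_1(x)=v_p(x),$$ where $b_1(x)\in\{1,\dots,p-1\}$ is the unique element with $b_1(x)\equiv p^{a_1(x)}/x \pmod p$. Let $F=\bigcup_{k\ge 0}T_p^{-k}(0)$ and, for $x\in p\mathbb{Z}_p\setminus F$ and $i\geq 1$, let $a_i(x)=a_1(T_p^{i-1}x)$, $b_i(x)=b_1(T_p^{i-1}x)$, and $$\frac{p_n(x)}{q_n(x)}=\cfrac{p^{a_1(x)}}{b_1(x)+\cfrac{p^{a_2(x)}}{b_2(x)+\cdots+\cfrac{p^{a_n(x)}}{b_n(x)}}}.$$ For $\alpha\geq\log p$ let $A_\alpha$ be the set of those $x\in p\mathbb{Z}_p\setminus F$ for which the limit below exists and $$-\lim_{n\to\infty}\frac1n\log\left|x-\frac{p_n(x)}{q_n(x)}\right|_p=\alpha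 .$$ Then, with respect to the $p$-adic metric, for every $\alpha>\log p$, $$\dim_{\mathrm H}A_\alpha=\frac{\log(p-1)+\log(\alpha-\log p)-\log\log p+\alpha\log_p\alpha-\alpha\log_p(\alpha-\log p)}{\alpha},$$ and, for $\alpha=\log p$, $$\dim_{\mathrm H}A_{\log p}=\frac{\log(p-1)}{\log p}$$ (the limit of the formula above as $\alpha\downarrow\log p$). -/

import Mathlib

open Filter Topology

noncomputable section

namespace Schneider

variable (p : ℕ) [Fact p.Prime]

/-- The maximal ideal `pℤ_p = {x : |x|_p < 1}`, as a subset of `ℚ_p` with its `p`-adic metric. -/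
def pZp : Set ℚ_[p] := {x | ‖x‖ < 1}

variable {p}

/-- The digit `a₁(x) = v_p(x)` (used for `x ≠ 0`). -/
def digitA (x : ℚ_[p]) : ℤ := x.valuation

/-- For `x ≠ 0` there is exactly one `b ∈ {1, …, p - 1}` with `b ≡ p ^ a₁(x) / x (mod p)`. -/
theorem existsUnique_digitB (x : ℚ_[p]) (hx : x ≠ 0) :
    ∃! b : ℕ, 1 ≤ b ∧ b ≤ p - 1 ∧ (p : ℚ_[p]) ^ digitA x / x - (b : ℚ_[p]) ∈ pZp p := by
  have hp : p.Prime := Fact.out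
  have hu : ‖(p : ℚ_[p]) ^ digitA x / x‖ = 1 := by
    rw [norm_div, Padic.norm_p_zpow, Padic.norm_eq_zpow_neg_valuation hx, digitA]
    exact div_self (zpow_ne_zero _ (by exact_mod_cast hp.ne_zero))
  obtain ⟨u, hux⟩ : ∃ u : ℤ_[p], (u : ℚ_[p]) = (p : ℚ_[p]) ^ digitA x / x := ⟨⟨_, hu.le⟩, rfl⟩
  rw [← hux] at hu ⊢
  have key : ∀ b : ℕ, (u : ℚ_[p]) - (b : ℚ_[p]) ∈ pZp p ↔ PadicInt.toZMod u = (b : ZMod p) := by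
    intro b
    have h2 : u - (b : ℤ_[p]) ∈ RingHom.ker (PadicInt.toZMod (p := p)) ↔
        (p : ℤ_[p]) ∣ u - (b : ℤ_[p]) := by
      rw [PadicInt.ker_toZMod, PadicInt.maximalIdeal_eq_span_p, Ideal.mem_span_singleton]
    rw [← PadicInt.norm_lt_one_iff_dvd, RingHom.mem_ker, map_sub, map_natCast, sub_eq_zero] at h2
    rw [h2, PadicInt.norm_def]
    simp [pZp]
  have h0 : PadicInt.toZMod u ≠ 0 := by
    intro h
    have h3 := (key 0).2 (by simpa using h)
    simp [pZp, hu] at h3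
  have : NeZero p := ⟨hp.ne_zero⟩
  refine ⟨(PadicInt.toZMod u).val, ⟨?_, ?_, ?_⟩, ?_⟩
  · exact Nat.one_le_iff_ne_zero.2 (fun h => h0 ((ZMod.val_eq_zero _).1 h))
  · exact Nat.le_sub_one_of_lt (ZMod.val_lt _)
  · rw [key, ZMod.natCast_zmod_val]
  · rintro b ⟨hb1, hb2, hb3⟩
    rw [key] at hb3
    rw [hb3, ZMod.val_cast_of_lt (by have := hp.pos; omega)]

open Classical in
/-- The digit `b₁(x)`: the unique `b ∈ {1, …, p - 1}` with `b ≡ p ^ a₁(x) / x (mod p)`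
(and `0` at `x = 0`, where the digit is not used). -/
def digitB (x : ℚ_[p]) : ℕ :=
  if hx : x ≠ 0 then (existsUnique_digitB x hx).choose else 0

theorem digitB_spec (x : ℚ_[p]) (hx : x ≠ 0) :
    1 ≤ digitB x ∧ digitB x ≤ p - 1 ∧
      (p : ℚ_[p]) ^ digitA x / x - (digitB x : ℚ_[p]) ∈ pZp p := by
  rw [digitB, dif_pos hx]
  exact (existsUnique_digitB x hx).choose_spec.1

open Classical in
/-- The Schneider map: `T_p(0) = 0` and `T_p(x) = p ^ a₁(x) / x - b₁(x)` for `x ≠ 0`. -/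
def schneiderMap (x : ℚ_[p]) : ℚ_[p] :=
  if x = 0 then 0 else (p : ℚ_[p]) ^ digitA x / x - (digitB x : ℚ_[p])

theorem mapsTo_schneiderMap : Set.MapsTo (schneiderMap (p := p)) (pZp p) (pZp p) := by
  intro x hx
  by_cases h : x = 0
  · simpa [schneiderMap, h] using hx
  · simpa [schneiderMap, h] using (digitB_spec x h).2.2

variable (p) in
/-- The points of `pℤ_p` with a finite continued fraction expansion, `F = ⋃ₖ T_p⁻ᵏ(0)`. -/
def finiteExpansion : Set ℚ_[p] := {x ∈ pZp p | ∃ k : ℕ, schneiderMap^[k] x = 0}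

/-- The `n`-th truncation `p_n(x) / q_n(x)` of the Schneider continued fraction,
`p ^ a₁ / (b₁ + p ^ a₂ / (b₂ + ⋯ + p ^ aₙ / bₙ))` with `aᵢ = a₁(T_p^(i-1) x)` and
`bᵢ = b₁(T_p^(i-1) x)`, a rational number; the empty truncation is `0`. -/
def convergent : ℕ → ℚ_[p] → ℚ
  | 0, _ => 0
  | n + 1, x => (p : ℚ) ^ digitA x / ((digitB x : ℚ) + convergent n (schneiderMap x))

variable (p) in
/-- The set of `x ∈ pℤ_p ∖ F` with `-lim (1 / n) log |x - p_n(x) / q_n(x)|_p = α`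
(the limit exists and has this value). -/
def approximationLevelSet (α : ℝ) : Set ℚ_[p] :=
  {x ∈ pZp p \ finiteExpansion p |
    Tendsto (fun n : ℕ => -((1 / (n : ℝ)) * Real.log ‖x - (convergent n x : ℚ_[p])‖))
      atTop (𝓝 α)}

end Schneider

end

/-!
The Schneider map has the inverse branches `y ↦ p ^ a / (b + y)`, one for each digit pair `(a, b)`,
and on `pℤ_p` each of them is an exact similarity of ratio `p ^ (-a)`. Hence the points with infinite
expansion are coded without overlaps by all sequences of digit pairs (`codePoint`): points sharing
`n` digit pairs have distance at most `p ^ (-(a₁ + ⋯ + aₙ))` (`norm_codePoint_sub_le`), points at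
smaller distance than that share them (`eq_of_norm_codePoint_sub_lt`), and
`|x - pₙ / qₙ| = p ^ (-(a₁ + ⋯ + aₙ₊₁))` (`convergent_codePoint_mem`). The level set for `α` thus
consists of the points whose exponents `aᵢ` have mean `l = α / log p`
(`approximationLevelSet_eq_image`).

Among the laws of a digit pair with mean exponent `l`, the entropy is largest when `a` is geometric
with success probability `q = 1 / l` and `b` is independent and uniform. For the Bernoulli measure
with this marginal the mass of a cylinder depends only on its depth and on `a₁ + ⋯ + aₙ`, so on the
level set the ratio of the logarithms of the mass and of the diameter of a cylinder converges to
entropy divided by `l log p`, the claimed dimension. Covering by cylinders, whose masses add up to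
`1`, gives the upper bound (`dimH_le_of_pos`). By the strong law of large numbers the measure is
carried by the level set (`ae_tendsto_level_div`), and the mass distribution principle gives the
lower bound (`le_dimH_of_neg`); there a ball is compared with a cylinder one level less deep, which
costs nothing because `aₙ₊₁` is negligible against `a₁ + ⋯ + aₙ` on the level set. For `l = 1` the
lower bound uses `q = 1` and the upper bound lets `q` tend to `1`.
-/

namespace Schneider

open MeasureTheory ProbabilityTheory Set
open scoped ENNReal NNReal

variable {p : ℕ}

/-! ### Sequences of encoded digits -/

/-- The sum `a₁ + ⋯ + aₙ` of the first `n` exponents of a sequence of encoded digits. Throughout,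
a digit pair `(a, b)` with `a ≥ 1` and `1 ≤ b ≤ p - 1` is encoded as `(a - 1, b - 1)`. -/
def level (n : ℕ) (ω : ℕ → ℕ × Fin (p - 1)) : ℕ := ∑ i ∈ Finset.range n, ((ω i).1 + 1)

lemma level_succ' (n : ℕ) (ω : ℕ → ℕ × Fin (p - 1)) :
    level (n + 1) ω = ((ω 0).1 + 1) + level n fun i => ω (i + 1) := by
  rw [level, Finset.sum_range_succ', add_comm, level]

lemma le_level (n : ℕ) (ω : ℕ → ℕ × Fin (p - 1)) : n ≤ level n ω := by
  rw [level]
  calc n = ∑ i ∈ Finset.range n, 1 := by simp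
    _ ≤ _ := Finset.sum_le_sum fun i _ => Nat.le_add_left _ _

lemma level_mono (ω : ℕ → ℕ × Fin (p - 1)) : Monotone fun n => level n ω :=
  fun _ _ h => Finset.sum_le_sum_of_subset (Finset.range_subset_range.2 h)

lemma level_congr {n : ℕ} {ω ω' : ℕ → ℕ × Fin (p - 1)} (h : ∀ i < n, ω i = ω' i) :
    level n ω = level n ω' :=
  Finset.sum_congr rfl fun i hi => by rw [h i (Finset.mem_range.1 hi)]

/-- The probability `(1 - q) ^ (a - 1) * q / (p - 1)` of an encoded digit pair when `a` is
geometric with success probability `q` and `b` is uniform on `{1, …, p - 1}`. -/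
noncomputable def digitWeight (q : unitInterval) (e : ℕ × Fin (p - 1)) : ℝ :=
  (1 - q : ℝ) ^ e.1 * (q / ((p : ℝ) - 1))

lemma prod_digitWeight (q : unitInterval) (n : ℕ) (ω : ℕ → ℕ × Fin (p - 1)) :
    ∏ i ∈ Finset.range n, digitWeight q (ω i) =
      (1 - q : ℝ) ^ (level n ω - n) * (q / ((p : ℝ) - 1)) ^ n := by
  have : level n ω - n = ∑ i ∈ Finset.range n, (ω i).1 := by
    rw [level, Finset.sum_add_distrib]
    simp
  simp_rw [digitWeight, Finset.prod_mul_distrib, Finset.prod_pow_eq_pow_sum, this,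
    Finset.prod_const, Finset.card_range]

/-- The logarithm of the product of the weights of the first `n` digit pairs of `ω`, for
`0 < q < 1`. For `q = 1` the convention `Real.log 0 = 0` leaves an upper bound. -/
noncomputable def logMass (q : unitInterval) (n : ℕ) (ω : ℕ → ℕ × Fin (p - 1)) : ℝ :=
  n * Real.log (q / ((p : ℝ) - 1)) + ((level n ω : ℝ) - n) * Real.log (1 - q)

/-- Along a sequence whose exponents have mean `l`, this is the exponential rate of the quotient
of the mass of a cylinder of depth `n` by the `s`-th power of the diameter at depth `n + k`; its
sign decides on which side of the dimension `s` lies. -/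
lemma tendsto_logMass_add_div (q : unitInterval) (s : ℝ) {l : ℝ} (k : ℕ)
    {ω : ℕ → ℕ × Fin (p - 1)} (h : Tendsto (fun n : ℕ => (level n ω : ℝ) / n) atTop (𝓝 l)) :
    Tendsto (fun n : ℕ => (logMass q n ω + s * Real.log p * level (n + k) ω) / n) atTop
      (𝓝 (Real.log (q / ((p : ℝ) - 1)) + (l - 1) * Real.log (1 - q) + s * Real.log p * l)) := by
  have h2 : Tendsto (fun n : ℕ => ((n : ℝ) + k) / n) atTop (𝓝 1) := by
    simpa using (tendsto_natCast_div_add_atTop (k : ℝ)).inv₀ one_ne_zero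
  have h3 := (((tendsto_add_atTop_iff_nat k).2 h).mul h2)
  have h4 := (((h.sub_const 1).mul_const (Real.log (1 - q))).const_add
    (Real.log (q / ((p : ℝ) - 1)))).add (h3.const_mul (s * Real.log p))
  rw [mul_one] at h4
  refine h4.congr' ?_
  filter_upwards [eventually_gt_atTop 0] with n hn
  have : (n : ℝ) ≠ 0 := by positivity
  have : (n : ℝ) + k ≠ 0 := by positivity
  rw [logMass]
  push_cast
  field_simp

variable [hp : Fact p.Prime]

/-! ### The inverse branches of the Schneider map -/

/-- The inverse branch `y ↦ p ^ a / (b + y)` of the Schneider map; the digits `a ≥ 1` and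
`1 ≤ b ≤ p - 1` are encoded as the pair `e = (a - 1, b - 1)`. -/
noncomputable def branch (e : ℕ × Fin (p - 1)) (y : ℚ_[p]) : ℚ_[p] :=
  (p : ℚ_[p]) ^ (e.1 + 1) / (((e.2 + 1 : ℕ) : ℚ_[p]) + y)

lemma norm_natCast_eq_one {b : ℕ} (h1 : 1 ≤ b) (h2 : b ≤ p - 1) : ‖(b : ℚ_[p])‖ = 1 := by
  rw [Padic.norm_natCast_eq_one_iff, hp.out.coprime_iff_not_dvd]
  have := hp.out.pos
  exact Nat.not_dvd_of_pos_of_lt (by omega) (by omega)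

lemma norm_natCast_add {b : ℕ} (h1 : 1 ≤ b) (h2 : b ≤ p - 1) {y : ℚ_[p]} (hy : y ∈ pZp p) :
    ‖(b : ℚ_[p]) + y‖ = 1 := by
  have hb := norm_natCast_eq_one h1 h2
  have hy' : ‖y‖ < 1 := hy
  rw [Padic.add_eq_max_of_ne (by rw [hb]; exact hy'.ne'), hb, max_eq_left hy'.le]

lemma norm_succ_add (e : ℕ × Fin (p - 1)) {y : ℚ_[p]} (hy : y ∈ pZp p) :
    ‖((e.2 + 1 : ℕ) : ℚ_[p]) + y‖ = 1 :=
  norm_natCast_add (Nat.le_add_left _ _) (Nat.succ_le_of_lt e.2.2) hy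

lemma norm_branch (e : ℕ × Fin (p - 1)) {y : ℚ_[p]} (hy : y ∈ pZp p) :
    ‖branch e y‖ = ((p : ℝ)⁻¹) ^ (e.1 + 1) := by
  rw [branch, norm_div, norm_succ_add e hy, div_one, norm_pow, Padic.norm_p]

lemma inv_prime_pos : (0 : ℝ) < (p : ℝ)⁻¹ := by
  have := hp.out.pos
  positivity

lemma inv_prime_lt_one : (p : ℝ)⁻¹ < 1 :=
  inv_lt_one_of_one_lt₀ (by exact_mod_cast hp.out.one_lt)

lemma branch_ne_zero (e : ℕ × Fin (p - 1)) {y : ℚ_[p]} (hy : y ∈ pZp p) : branch e y ≠ 0 := by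
  rw [← norm_ne_zero_iff, norm_branch e hy]
  exact (pow_pos inv_prime_pos _).ne'

lemma norm_branch_le (e : ℕ × Fin (p - 1)) {y : ℚ_[p]} (hy : y ∈ pZp p) :
    ‖branch e y‖ ≤ (p : ℝ)⁻¹ := by
  rw [norm_branch e hy]
  exact pow_le_of_le_one inv_prime_pos.le inv_prime_lt_one.le (by omega)

lemma branch_mem (e : ℕ × Fin (p - 1)) {y : ℚ_[p]} (hy : y ∈ pZp p) : branch e y ∈ pZp p :=
  (norm_branch_le e hy).trans_lt inv_prime_lt_one

/-- Each inverse branch is a similarity of ratio `p ^ (-a)` on `pℤ_p`. -/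
lemma norm_branch_sub (e : ℕ × Fin (p - 1)) {y z : ℚ_[p]} (hy : y ∈ pZp p) (hz : z ∈ pZp p) :
    ‖branch e y - branch e z‖ = ((p : ℝ)⁻¹) ^ (e.1 + 1) * ‖y - z‖ := by
  have h1 := norm_succ_add e hy
  have h2 := norm_succ_add e hz
  have h1' : ((e.2 + 1 : ℕ) : ℚ_[p]) + y ≠ 0 := by rw [← norm_ne_zero_iff, h1]; exact one_ne_zero
  have h2' : ((e.2 + 1 : ℕ) : ℚ_[p]) + z ≠ 0 := by rw [← norm_ne_zero_iff, h2]; exact one_ne_zero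
  have : branch e y - branch e z = (p : ℚ_[p]) ^ (e.1 + 1) * (z - y) /
      ((((e.2 + 1 : ℕ) : ℚ_[p]) + y) * (((e.2 + 1 : ℕ) : ℚ_[p]) + z)) := by
    rw [branch, branch, div_sub_div _ _ h1' h2']
    ring
  rw [this, norm_div, norm_mul, norm_mul, h1, h2, norm_pow, Padic.norm_p, norm_sub_rev z y]
  simp

lemma digitA_branch (e : ℕ × Fin (p - 1)) {y : ℚ_[p]} (hy : y ∈ pZp p) :
    digitA (branch e y) = e.1 + 1 := by
  have h := Padic.norm_eq_zpow_neg_valuation (branch_ne_zero e hy)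
  rw [norm_branch e hy, inv_pow, ← zpow_natCast, ← zpow_neg] at h
  have := zpow_right_injective₀ (by exact_mod_cast hp.out.pos)
    (by exact_mod_cast hp.out.one_lt.ne') h
  rw [digitA]
  push_cast at this
  linarith

lemma zpow_digitA_div_branch (e : ℕ × Fin (p - 1)) {y : ℚ_[p]} (hy : y ∈ pZp p) :
    (p : ℚ_[p]) ^ digitA (branch e y) / branch e y = ((e.2 + 1 : ℕ) : ℚ_[p]) + y := by
  have h0 : (p : ℚ_[p]) ^ (e.1 + 1) ≠ 0 := pow_ne_zero _ (by exact_mod_cast hp.out.ne_zero)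
  rw [digitA_branch e hy, branch, ← Nat.cast_succ, zpow_natCast, div_div_cancel₀ h0]

lemma digitB_branch (e : ℕ × Fin (p - 1)) {y : ℚ_[p]} (hy : y ∈ pZp p) :
    digitB (branch e y) = e.2 + 1 := by
  have hx := branch_ne_zero e hy
  refine (existsUnique_digitB _ hx).unique (digitB_spec _ hx)
    ⟨Nat.le_add_left _ _, Nat.succ_le_of_lt e.2.2, ?_⟩
  rw [zpow_digitA_div_branch e hy, add_sub_cancel_left]
  exact hy

lemma schneiderMap_branch (e : ℕ × Fin (p - 1)) {y : ℚ_[p]} (hy : y ∈ pZp p) :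
    schneiderMap (branch e y) = y := by
  rw [schneiderMap, if_neg (branch_ne_zero e hy), zpow_digitA_div_branch e hy,
    digitB_branch e hy, add_sub_cancel_left]

lemma exists_branch_eq {x : ℚ_[p]} (hx : x ∈ pZp p) (h0 : x ≠ 0) :
    ∃ e : ℕ × Fin (p - 1), branch e (schneiderMap x) = x := by
  obtain ⟨h1, h2, -⟩ := digitB_spec x h0
  have ha : 1 ≤ x.valuation := by
    have hx' : ‖x‖ < 1 := hx
    rw [Padic.norm_eq_zpow_neg_valuation h0,
      zpow_lt_one_iff_right₀ (by exact_mod_cast hp.out.one_lt)] at hx'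
    omega
  refine ⟨(x.valuation.toNat - 1, ⟨digitB x - 1, by omega⟩), ?_⟩
  have e1 : digitB x - 1 + 1 = digitB x := by omega
  have e2 : x.valuation.toNat - 1 + 1 = x.valuation.toNat := by omega
  have e3 : (p : ℚ_[p]) ^ x.valuation.toNat = (p : ℚ_[p]) ^ x.valuation := by
    rw [← zpow_natCast, Int.toNat_of_nonneg (by omega)]
  have h3 : (p : ℚ_[p]) ^ x.valuation ≠ 0 := zpow_ne_zero _ (by exact_mod_cast hp.out.ne_zero)
  rw [branch, schneiderMap, if_neg h0]
  simp only [e1, e2, e3, digitA, add_sub_cancel]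
  exact div_div_cancel₀ h3

/-! ### Symbolic coding of the points with infinite expansion -/

/-- The composition of the first `n` inverse branches prescribed by `ω`, applied to `0`. -/
noncomputable def truncatedCode : ℕ → (ℕ → ℕ × Fin (p - 1)) → ℚ_[p]
  | 0, _ => 0
  | n + 1, ω => branch (ω 0) (truncatedCode n fun i => ω (i + 1))

/-- The point of `pℤ_p` whose continued fraction digits are prescribed by `ω`. -/
noncomputable def codePoint (ω : ℕ → ℕ × Fin (p - 1)) : ℚ_[p] :=
  limUnder atTop fun n => truncatedCode n ω

lemma norm_truncatedCode_le (n : ℕ) (ω : ℕ → ℕ × Fin (p - 1)) :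
    ‖truncatedCode n ω‖ ≤ (p : ℝ)⁻¹ := by
  induction n generalizing ω with
  | zero => simp [truncatedCode]
  | succ n ih => exact norm_branch_le _ ((ih _).trans_lt inv_prime_lt_one)

lemma truncatedCode_mem (n : ℕ) (ω : ℕ → ℕ × Fin (p - 1)) : truncatedCode n ω ∈ pZp p :=
  (norm_truncatedCode_le n ω).trans_lt inv_prime_lt_one

lemma norm_truncatedCode_sub_succ_le (n : ℕ) (ω : ℕ → ℕ × Fin (p - 1)) :
    ‖truncatedCode n ω - truncatedCode (n + 1) ω‖ ≤ ((p : ℝ)⁻¹) ^ n := by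
  induction n generalizing ω with
  | zero =>
    simpa [truncatedCode] using (norm_truncatedCode_le 1 ω).trans inv_prime_lt_one.le
  | succ n ih =>
    rw [truncatedCode, truncatedCode,
      norm_branch_sub _ (truncatedCode_mem _ _) (truncatedCode_mem _ _), pow_succ' _ n]
    refine mul_le_mul ?_ (ih _) (norm_nonneg _) inv_prime_pos.le
    exact pow_le_of_le_one inv_prime_pos.le inv_prime_lt_one.le (by omega)

lemma tendsto_truncatedCode (ω : ℕ → ℕ × Fin (p - 1)) :
    Tendsto (fun n => truncatedCode n ω) atTop (𝓝 (codePoint ω)) := by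
  refine CauchySeq.tendsto_limUnder (cauchySeq_of_le_geometric ((p : ℝ)⁻¹) 1 inv_prime_lt_one
    fun n => ?_)
  rw [dist_eq_norm, one_mul]
  exact norm_truncatedCode_sub_succ_le n ω

lemma codePoint_mem (ω : ℕ → ℕ × Fin (p - 1)) : codePoint ω ∈ pZp p :=
  (le_of_tendsto (tendsto_truncatedCode ω).norm
    (Eventually.of_forall fun n => norm_truncatedCode_le n ω)).trans_lt inv_prime_lt_one

lemma codePoint_eq_branch (ω : ℕ → ℕ × Fin (p - 1)) :
    codePoint ω = branch (ω 0) (codePoint fun i => ω (i + 1)) := by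
  refine tendsto_nhds_unique ((tendsto_add_atTop_iff_nat 1).2 (tendsto_truncatedCode ω)) ?_
  have h := tendsto_truncatedCode fun i => ω (i + 1)
  rw [tendsto_iff_norm_sub_tendsto_zero] at h ⊢
  simpa [truncatedCode, norm_branch_sub _ (truncatedCode_mem _ _) (codePoint_mem _)] using
    h.const_mul (((p : ℝ)⁻¹) ^ ((ω 0).1 + 1))

lemma schneiderMap_codePoint (ω : ℕ → ℕ × Fin (p - 1)) :
    schneiderMap (codePoint ω) = codePoint fun i => ω (i + 1) := by
  rw [codePoint_eq_branch ω, schneiderMap_branch _ (codePoint_mem _)]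

lemma norm_codePoint (ω : ℕ → ℕ × Fin (p - 1)) :
    ‖codePoint ω‖ = ((p : ℝ)⁻¹) ^ ((ω 0).1 + 1) := by
  rw [codePoint_eq_branch ω, norm_branch _ (codePoint_mem _)]

lemma codePoint_ne_zero (ω : ℕ → ℕ × Fin (p - 1)) : codePoint ω ≠ 0 := by
  rw [codePoint_eq_branch ω]
  exact branch_ne_zero _ (codePoint_mem _)

lemma norm_codePoint_sub_le {n : ℕ} {ω ω' : ℕ → ℕ × Fin (p - 1)} (h : ∀ i < n, ω i = ω' i) :
    ‖codePoint ω - codePoint ω'‖ ≤ ((p : ℝ)⁻¹) ^ level n ω := by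
  induction n generalizing ω ω' with
  | zero =>
    have h1 : ‖codePoint ω‖ < 1 := codePoint_mem ω
    have h2 : ‖codePoint ω'‖ < 1 := codePoint_mem ω'
    rw [level, Finset.sum_range_zero, pow_zero, sub_eq_add_neg]
    exact (Padic.nonarchimedean _ _).trans (max_le h1.le (by rw [norm_neg]; exact h2.le))
  | succ n ih =>
    rw [codePoint_eq_branch ω, codePoint_eq_branch ω', ← h 0 n.succ_pos,
      norm_branch_sub _ (codePoint_mem _) (codePoint_mem _), level_succ', pow_add _ (_ + 1)]
    exact mul_le_mul_of_nonneg_left (ih fun i hi => h (i + 1) (by omega))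
      (pow_pos (inv_prime_pos (p := p)) _).le

/-- If two nonzero points are closer than the norm of the first, then their first digits
agree. -/
lemma digits_eq_of_norm_branch_sub_lt {e f : ℕ × Fin (p - 1)} {y z : ℚ_[p]} (hy : y ∈ pZp p)
    (hz : z ∈ pZp p) (h : ‖branch e y - branch f z‖ < ((p : ℝ)⁻¹) ^ (e.1 + 1)) : e = f := by
  have hn : ‖branch e y‖ = ‖branch f z‖ := by
    refine Padic.norm_eq_of_norm_sub_lt_left ?_
    rwa [norm_branch e hy]
  have ha : e.1 = f.1 := by
    rw [norm_branch e hy, norm_branch f hz] at hn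
    have := pow_right_injective₀ inv_prime_pos inv_prime_lt_one.ne hn
    simpa using this
  have h1 := norm_succ_add e hy
  have h2 := norm_succ_add f hz
  have h1' : ((e.2 + 1 : ℕ) : ℚ_[p]) + y ≠ 0 := by rw [← norm_ne_zero_iff, h1]; exact one_ne_zero
  have h2' : ((f.2 + 1 : ℕ) : ℚ_[p]) + z ≠ 0 := by rw [← norm_ne_zero_iff, h2]; exact one_ne_zero
  have key : branch e y - branch f z = (p : ℚ_[p]) ^ (e.1 + 1) *
      ((((f.2 + 1 : ℕ) : ℚ_[p]) + z) - (((e.2 + 1 : ℕ) : ℚ_[p]) + y)) /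
      ((((e.2 + 1 : ℕ) : ℚ_[p]) + y) * (((f.2 + 1 : ℕ) : ℚ_[p]) + z)) := by
    rw [branch, branch, ← ha]
    field_simp
  rw [key, norm_div, norm_mul, norm_mul, h1, h2, norm_pow, Padic.norm_p, mul_one, div_one,
    mul_lt_iff_lt_one_right (pow_pos inv_prime_pos _)] at h
  have hdiff : ‖(((f.2 + 1 : ℕ) : ℚ_[p]) + z) - ((e.2 + 1 : ℕ) : ℚ_[p])‖ < 1 := by
    have : (((f.2 + 1 : ℕ) : ℚ_[p]) + z) - ((e.2 + 1 : ℕ) : ℚ_[p]) =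
      ((((f.2 + 1 : ℕ) : ℚ_[p]) + z) - (((e.2 + 1 : ℕ) : ℚ_[p]) + y)) + y := by ring
    rw [this]
    exact (Padic.nonarchimedean _ _).trans_lt (max_lt h hy)
  have hb : digitB (branch f z) = e.2 + 1 := by
    have hx := branch_ne_zero f hz
    refine (existsUnique_digitB _ hx).unique (digitB_spec _ hx)
      ⟨Nat.le_add_left _ _, Nat.succ_le_of_lt e.2.2, ?_⟩
    rw [zpow_digitA_div_branch f hz]
    exact hdiff
  rw [digitB_branch f hz] at hb
  exact Prod.ext ha (Fin.ext (by omega))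

/-- A ball around `codePoint ω` of radius below `p ^ (-(a₁ + ⋯ + aₙ))` meets only the cylinder
of the first `n` digits of `ω`. -/
lemma eq_of_norm_codePoint_sub_lt {n : ℕ} {ω ω' : ℕ → ℕ × Fin (p - 1)}
    (h : ‖codePoint ω - codePoint ω'‖ < ((p : ℝ)⁻¹) ^ level n ω) : ∀ i < n, ω i = ω' i := by
  induction n generalizing ω ω' with
  | zero => intro i hi; omega
  | succ n ih =>
    rw [codePoint_eq_branch ω, codePoint_eq_branch ω', level_succ', pow_add] at h
    have h0 : ω 0 = ω' 0 := by
      refine digits_eq_of_norm_branch_sub_lt (codePoint_mem _) (codePoint_mem _) (h.trans_le ?_)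
      exact mul_le_of_le_one_right (pow_nonneg inv_prime_pos.le _)
        (pow_le_one₀ inv_prime_pos.le inv_prime_lt_one.le)
    rw [← h0, norm_branch_sub _ (codePoint_mem _) (codePoint_mem _),
      mul_lt_mul_iff_right₀ (pow_pos inv_prime_pos _)] at h
    intro i hi
    cases i with
    | zero => exact h0
    | succ i => exact ih h i (by omega)

lemma convergent_codePoint_mem (n : ℕ) (ω : ℕ → ℕ × Fin (p - 1)) :
    ((convergent n (codePoint ω) : ℚ) : ℚ_[p]) ∈ pZp p ∧
      ‖codePoint ω - ((convergent n (codePoint ω) : ℚ) : ℚ_[p])‖ =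
        ((p : ℝ)⁻¹) ^ level (n + 1) ω := by
  induction n generalizing ω with
  | zero => simp [convergent, level, norm_codePoint, pZp]
  | succ n ih =>
    obtain ⟨h1, h2⟩ := ih fun i => ω (i + 1)
    have : ((convergent (n + 1) (codePoint ω) : ℚ) : ℚ_[p]) =
        branch (ω 0) ((convergent n (codePoint fun i => ω (i + 1)) : ℚ) : ℚ_[p]) := by
      rw [convergent, schneiderMap_codePoint, branch]
      rw [codePoint_eq_branch ω, digitA_branch _ (codePoint_mem _),
        digitB_branch _ (codePoint_mem _)]
      push_cast
      norm_cast
    rw [this]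
    refine ⟨branch_mem _ h1, ?_⟩
    conv_lhs => rw [codePoint_eq_branch ω]
    rw [norm_branch_sub _ (codePoint_mem _) h1, h2, level_succ' (n + 1), pow_add _ (_ + 1)]

lemma iterate_schneiderMap_codePoint (n : ℕ) (ω : ℕ → ℕ × Fin (p - 1)) :
    schneiderMap^[n] (codePoint ω) = codePoint fun i => ω (i + n) := by
  induction n generalizing ω with
  | zero => rfl
  | succ n ih =>
    rw [Function.iterate_succ_apply, schneiderMap_codePoint, ih]
    simp only [add_assoc, add_comm n 1]

lemma codePoint_notMem_finiteExpansion (ω : ℕ → ℕ × Fin (p - 1)) :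
    codePoint ω ∉ finiteExpansion p := by
  rintro ⟨-, k, hk⟩
  rw [iterate_schneiderMap_codePoint] at hk
  exact codePoint_ne_zero _ hk

lemma exists_codePoint_eq {x : ℚ_[p]} (hx : x ∈ pZp p \ finiteExpansion p) :
    ∃ ω : ℕ → ℕ × Fin (p - 1), codePoint ω = x := by
  have hmem : ∀ n, schneiderMap^[n] x ∈ pZp p := fun n =>
    mapsTo_schneiderMap.iterate n hx.1
  have hne : ∀ n, schneiderMap^[n] x ≠ 0 := fun n h => hx.2 ⟨hx.1, n, h⟩
  choose ω hω using fun n => exists_branch_eq (hmem n) (hne n)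
  refine ⟨ω, ?_⟩
  have key : ∀ n k, ‖codePoint (fun i => ω (i + k)) - schneiderMap^[k] x‖ ≤ ((p : ℝ)⁻¹) ^ n := by
    intro n
    induction n with
    | zero =>
      intro k
      have h1 : ‖codePoint fun i => ω (i + k)‖ < 1 := codePoint_mem _
      have h2 : ‖schneiderMap^[k] x‖ < 1 := hmem k
      rw [pow_zero, sub_eq_add_neg]
      exact (Padic.nonarchimedean _ _).trans (max_le h1.le (by rw [norm_neg]; exact h2.le))
    | succ n ih =>
      intro k
      have hm := hmem (k + 1)
      have hi := ih (k + 1)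
      rw [Function.iterate_succ_apply'] at hm hi
      rw [← hω k, codePoint_eq_branch]
      simp only [zero_add, add_right_comm _ 1 k]
      rw [norm_branch_sub _ (codePoint_mem _) hm, pow_succ' _ n]
      refine mul_le_mul ?_ hi (norm_nonneg _) inv_prime_pos.le
      exact pow_le_of_le_one inv_prime_pos.le inv_prime_lt_one.le (by omega)
  have h0 : ‖codePoint ω - x‖ ≤ 0 :=
    ge_of_tendsto' (tendsto_pow_atTop_nhds_zero_of_lt_one inv_prime_pos.le inv_prime_lt_one)
      fun n => key n 0
  exact sub_eq_zero.1 (norm_le_zero_iff.1 h0)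

/-- In the coding, the approximation level sets are the level sets of the Birkhoff averages of
the exponents. -/
lemma approximationLevelSet_eq_image (l : ℝ) :
    approximationLevelSet p (l * Real.log p) = codePoint ''
      {ω : ℕ → ℕ × Fin (p - 1) | Tendsto (fun n : ℕ => (level n ω : ℝ) / n) atTop (𝓝 l)} := by
  have hlog : 0 < Real.log p := Real.log_pos (by exact_mod_cast hp.out.one_lt)
  have key : ∀ ω : ℕ → ℕ × Fin (p - 1),
      (codePoint ω ∈ approximationLevelSet p (l * Real.log p) ↔
        Tendsto (fun n : ℕ => (level n ω : ℝ) / n) atTop (𝓝 l)) := by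
    intro ω
    have h1 : ∀ n : ℕ, -((1 / (n : ℝ)) * Real.log
        ‖codePoint ω - ((convergent n (codePoint ω) : ℚ) : ℚ_[p])‖) =
        (level (n + 1) ω : ℝ) / n * Real.log p := by
      intro n
      rw [(convergent_codePoint_mem n ω).2, Real.log_pow, Real.log_inv]
      ring
    have h2 : Tendsto (fun n : ℕ => ((n : ℝ) + 1) / n) atTop (𝓝 1) := by
      have := tendsto_natCast_div_add_atTop (1 : ℝ)
      simpa using this.inv₀ one_ne_zero
    rw [approximationLevelSet, mem_ofPred_eq]
    simp only [h1]
    rw [← tendsto_add_atTop_iff_nat 1 (f := fun n : ℕ => (level n ω : ℝ) / n)]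
    constructor
    · rintro ⟨-, h⟩
      have h3 := (h.div_const (Real.log p)).div h2 one_ne_zero
      simp only [mul_div_assoc, div_self hlog.ne', mul_one, div_one] at h3
      refine h3.congr' ?_
      filter_upwards [eventually_gt_atTop 0] with n hn
      have : (n : ℝ) ≠ 0 := by positivity
      simp only [Pi.div_apply]
      push_cast
      field_simp
    · intro h
      refine ⟨⟨codePoint_mem _, codePoint_notMem_finiteExpansion _⟩, ?_⟩
      have h3 := (h.mul h2).mul_const (Real.log p)
      rw [mul_one] at h3
      refine h3.congr' ?_
      filter_upwards [eventually_gt_atTop 0] with n hn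
      have : (n : ℝ) ≠ 0 := by positivity
      push_cast
      field_simp
  ext x
  constructor
  · intro hx
    obtain ⟨ω, rfl⟩ := exists_codePoint_eq hx.1
    exact ⟨ω, (key ω).1 hx, rfl⟩
  · rintro ⟨ω, hω, rfl⟩
    exact (key ω).2 hω

lemma continuous_codePoint : Continuous (codePoint (p := p)) := by
  rw [continuous_iff_continuousAt]
  intro ω
  rw [ContinuousAt, tendsto_iff_norm_sub_tendsto_zero, Metric.tendsto_nhds]
  intro ε hε
  obtain ⟨n, hn⟩ := exists_pow_lt_of_lt_one hε (inv_prime_lt_one (p := p))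
  have : ∀ᶠ ω' in 𝓝 ω, ∀ i ∈ Finset.range n, ω' i = ω i := by
    rw [Filter.eventually_all_finset]
    intro i _
    exact (continuous_apply i).continuousAt.eventually (isOpen_discrete {ω i} |>.mem_nhds rfl)
  filter_upwards [this] with ω' h
  rw [dist_zero_right, norm_norm, norm_sub_rev]
  refine (norm_codePoint_sub_le (n := n) fun i hi => (h i (Finset.mem_range.2 hi)).symm).trans_lt ?_
  exact (pow_le_pow_of_le_one inv_prime_pos.le inv_prime_lt_one.le (le_level n ω)).trans_lt hn

/-! ### Bernoulli measures on digit sequences -/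

instance : Nonempty (Fin (p - 1)) := ⟨⟨0, by have := hp.out.two_le; omega⟩⟩

/-- The law of one encoded digit pair: the exponent `a - 1` is geometric with success probability
`q`, and `b` is independent of it and uniform. -/
noncomputable def digitLaw (p : ℕ) (q : unitInterval) : Measure (ℕ × Fin (p - 1)) :=
  (geometricMeasure q).prod (uniformOn univ)

instance (q : unitInterval) : IsProbabilityMeasure (digitLaw p q) := by
  have : IsProbabilityMeasure (uniformOn (univ : Set (Fin (p - 1)))) :=
    isProbabilityMeasure_uniformOn finite_univ univ_nonempty
  unfold digitLaw
  infer_instance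

lemma sub_one_pos : (0 : ℝ) < (p : ℝ) - 1 :=
  sub_pos.2 (by exact_mod_cast hp.out.one_lt)

lemma digitWeight_nonneg (q : unitInterval) (e : ℕ × Fin (p - 1)) : 0 ≤ digitWeight q e :=
  mul_nonneg (pow_nonneg (sub_nonneg.2 q.2.2) _) (div_nonneg q.2.1 sub_one_pos.le)

lemma digitLaw_singleton {q : unitInterval} (hq : q ≠ 0) (e : ℕ × Fin (p - 1)) :
    digitLaw p q {e} = ENNReal.ofReal (digitWeight q e) := by
  have : IsProbabilityMeasure (uniformOn (univ : Set (Fin (p - 1)))) :=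
    isProbabilityMeasure_uniformOn finite_univ univ_nonempty
  have hp1 : ((p - 1 : ℕ) : ℝ) = (p : ℝ) - 1 := by
    rw [Nat.cast_sub hp.out.one_le, Nat.cast_one]
  have hu : uniformOn (univ : Set (Fin (p - 1))) {e.2} = ENNReal.ofReal (1 / ((p : ℝ) - 1)) := by
    rw [uniformOn_univ, Measure.count_singleton, Fintype.card_fin, ← hp1,
      ENNReal.ofReal_div_of_pos (by rw [hp1]; exact sub_one_pos), ENNReal.ofReal_one,
      ENNReal.ofReal_natCast]
  rw [← Prod.mk.eta (p := e), ← singleton_prod_singleton, digitLaw, Measure.prod_prod,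
    geometricMeasure_singleton hq, hu, ← ENNReal.ofReal_mul (geometricMeasure_nonneg q _),
    digitWeight]
  congr 1
  ring

/-- The law of a sequence of independent encoded digit pairs of law `digitLaw p q`. -/
noncomputable def sequenceLaw (p : ℕ) [Fact p.Prime] (q : unitInterval) :
    Measure (ℕ → ℕ × Fin (p - 1)) :=
  Measure.infinitePi fun _ => digitLaw p q

instance (q : unitInterval) : IsProbabilityMeasure (sequenceLaw p q) := by
  unfold sequenceLaw
  infer_instance

lemma sequenceLaw_cylinder {q : unitInterval} (hq : q ≠ 0) (n : ℕ) (ω : ℕ → ℕ × Fin (p - 1)) :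
    sequenceLaw p q {ω' | ∀ i < n, ω i = ω' i} =
      ENNReal.ofReal (∏ i ∈ Finset.range n, digitWeight q (ω i)) := by
  have : {ω' : ℕ → ℕ × Fin (p - 1) | ∀ i < n, ω i = ω' i} =
      Set.pi (Finset.range n) fun i => {ω i} := by
    ext ω'
    simp [Set.mem_pi, eq_comm]
  rw [this, sequenceLaw, Measure.infinitePi_pi _ fun i _ => measurableSet_singleton _,
    ENNReal.ofReal_prod_of_nonneg fun i _ => digitWeight_nonneg _ _]
  exact Finset.prod_congr rfl fun i _ => digitLaw_singleton hq _

lemma tsum_prod_digitWeight {q : unitInterval} (hq : q ≠ 0) (n : ℕ) :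
    ∑' w : Fin n → ℕ × Fin (p - 1), ENNReal.ofReal (∏ i, digitWeight q (w i)) = 1 := by
  have h : ∀ w : Fin n → ℕ × Fin (p - 1), ENNReal.ofReal (∏ i, digitWeight q (w i)) =
      Measure.pi (fun _ => digitLaw p q) {w} := by
    intro w
    rw [Measure.pi_singleton, ENNReal.ofReal_prod_of_nonneg fun i _ => digitWeight_nonneg _ _]
    exact Finset.prod_congr rfl fun i _ => (digitLaw_singleton hq _).symm
  simp_rw [h]
  have := Measure.tsum_indicator_apply_singleton
    (Measure.pi fun _ : Fin n => digitLaw p q) univ MeasurableSet.univ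
  simpa using this

lemma exp_logMass {q : unitInterval} (hq : q ≠ 0) (n : ℕ) (ω : ℕ → ℕ × Fin (p - 1)) :
    Real.exp (logMass q n ω) =
      Real.exp ((level n ω - n : ℕ) * Real.log (1 - q)) * (q / ((p : ℝ) - 1)) ^ n := by
  have hq' : (0 : ℝ) < q := unitInterval.pos_iff_ne_zero.2 hq
  rw [logMass, Real.exp_add, mul_comm, Nat.cast_sub (le_level n ω), Real.exp_nat_mul,
    Real.exp_log (div_pos hq' sub_one_pos)]

lemma prod_digitWeight_eq_exp {q : unitInterval} (hq : q ≠ 0) (hq1 : q ≠ 1) (n : ℕ)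
    (ω : ℕ → ℕ × Fin (p - 1)) :
    ∏ i ∈ Finset.range n, digitWeight q (ω i) = Real.exp (logMass q n ω) := by
  have hq' : (0 : ℝ) < 1 - q := sub_pos.2 (unitInterval.lt_one_iff_ne_one.2 hq1)
  rw [prod_digitWeight, exp_logMass hq, Real.exp_nat_mul, Real.exp_log hq']

/-- Equality can fail for `q = 1`: the right side is positive for every `ω`, because
`Real.log 0 = 0`, while the left side vanishes as soon as one of the first `n` exponents
exceeds `1`. -/
lemma prod_digitWeight_le_exp {q : unitInterval} (hq : q ≠ 0) (n : ℕ)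
    (ω : ℕ → ℕ × Fin (p - 1)) :
    ∏ i ∈ Finset.range n, digitWeight q (ω i) ≤ Real.exp (logMass q n ω) := by
  rcases eq_or_ne q 1 with rfl | hq1
  · rw [prod_digitWeight, exp_logMass hq]
    refine mul_le_mul_of_nonneg_right ?_ (pow_nonneg (div_nonneg zero_le_one sub_one_pos.le) _)
    simpa using pow_le_one₀ le_rfl zero_le_one
  · exact (prod_digitWeight_eq_exp hq hq1 n ω).le

/-- The strong law of large numbers for the exponents. -/
lemma ae_tendsto_level_div {q : unitInterval} (hq : q ≠ 0) :
    ∀ᵐ ω ∂sequenceLaw p q,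
      Tendsto (fun n : ℕ => (level n ω : ℝ) / n) atTop (𝓝 ((q : ℝ)⁻¹)) := by
  have : IsProbabilityMeasure (uniformOn (univ : Set (Fin (p - 1)))) :=
    isProbabilityMeasure_uniformOn finite_univ univ_nonempty
  have hq' : (0 : ℝ) < q := unitInterval.pos_iff_ne_zero.2 hq
  have hr0 : (0 : ℝ) ≤ 1 - q := sub_nonneg.2 q.2.2
  have hr1 : (1 - q : ℝ) < 1 := by linarith
  have hr : ‖(1 - q : ℝ)‖ < 1 := by rwa [Real.norm_of_nonneg hr0]
  have hsum : HasSum (fun n : ℕ => (1 - q : ℝ) ^ n * q * ((n : ℝ) + 1)) ((q : ℝ)⁻¹) := by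
    have h := ((hasSum_coe_mul_geometric_of_norm_lt_one hr).add
      (hasSum_geometric_of_lt_one hr0 hr1)).mul_left (q : ℝ)
    have hv : (q : ℝ)⁻¹ = q * ((1 - q) / (1 - (1 - q : ℝ)) ^ 2 + (1 - (1 - q : ℝ))⁻¹) := by
      rw [sub_sub_cancel]
      field_simp
      ring
    rw [hv]
    refine h.congr_fun fun n => ?_
    ring
  have hmp : ∀ i : ℕ, MeasurePreserving (fun ω : ℕ → ℕ × Fin (p - 1) => (ω i).1)
      (sequenceLaw p q) (geometricMeasure q) := fun i =>
    measurePreserving_fst.comp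
      (measurePreserving_eval_infinitePi (fun _ : ℕ => digitLaw p q) i)
  set X : ℕ → (ℕ → ℕ × Fin (p - 1)) → ℝ := fun i ω => ((ω i).1 : ℝ) + 1 with hX
  have hg : Measurable fun n : ℕ => (n : ℝ) + 1 := measurable_of_countable _
  have hint : Integrable (fun n : ℕ => (n : ℝ) + 1) (geometricMeasure q) := by
    rw [integrable_geometricMeasure_iff hq]
    refine hsum.summable.congr fun n => ?_
    rw [Real.norm_of_nonneg (by positivity)]
  have hmean : (sequenceLaw p q)[X 0] = (q : ℝ)⁻¹ := by
    have h1 := integral_map (μ := sequenceLaw p q) (hmp 0).measurable.aemeasurable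
      (f := fun n : ℕ => (n : ℝ) + 1) hg.aestronglyMeasurable
    rw [(hmp 0).map_eq, integral_geometricMeasure hq] at h1
    rw [← hsum.tsum_eq]
    exact h1.symm
  have hlln := strong_law_ae_real (μ := sequenceLaw p q) X
    ((hmp 0).integrable_comp_of_integrable hint)
    (fun i j hij => (iIndepFun_infinitePi (P := fun _ : ℕ => digitLaw p q)
      (X := fun _ (e : ℕ × Fin (p - 1)) => (e.1 : ℝ) + 1)
      (fun _ => measurable_of_countable _)).indepFun hij)
    (fun i => ⟨(hg.comp (hmp i).measurable).aemeasurable, (hg.comp (hmp 0).measurable).aemeasurable,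
      by
        change Measure.map ((fun n : ℕ => (n : ℝ) + 1) ∘ fun ω : ℕ → ℕ × Fin (p - 1) => (ω i).1) _
          = Measure.map ((fun n : ℕ => (n : ℝ) + 1) ∘ fun ω : ℕ → ℕ × Fin (p - 1) => (ω 0).1) _
        rw [← Measure.map_map hg (hmp i).measurable, ← Measure.map_map hg (hmp 0).measurable,
          (hmp i).map_eq, (hmp 0).map_eq]⟩)
  rw [hmean] at hlln
  filter_upwards [hlln] with ω hω
  simpa [level, hX] using hω

lemma exp_neg_mul_log_mul_level (s : ℝ) (m : ℕ) :
    Real.exp (-(s * Real.log p * m)) = (((p : ℝ)⁻¹) ^ m) ^ s := by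
  rw [Real.rpow_def_of_pos (pow_pos inv_prime_pos _), Real.log_pow, Real.log_inv]
  congr 1
  ring

/-! ### The upper bound for the dimension -/

/-- On a set of points whose cylinders `C` of depth `n` eventually satisfy
`diam C ^ s ≤ exp (-n δ) * (mass of C)`, the covers by cylinders show that the `s`-dimensional
Hausdorff measure vanishes, as the masses add up to `1`. -/
lemma dimH_image_codePoint_le {q : unitInterval} (hq : q ≠ 0) (hq1 : q ≠ 1) {s : ℝ≥0}
    (hs : 0 < s) {δ : ℝ} (hδ : 0 < δ) {N : ℕ} {B : Set (ℕ → ℕ × Fin (p - 1))}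
    (hB : ∀ ω ∈ B, ∀ n ≥ N, n * δ ≤ logMass q n ω + s * Real.log p * level n ω) :
    dimH (codePoint '' B) ≤ s := by
  borelize ℚ_[p]
  refine dimH_le_of_hausdorffMeasure_ne_top ?_
  let t : ∀ n : ℕ, (Fin n → ℕ × Fin (p - 1)) → Set ℚ_[p] := fun n w =>
    codePoint '' {ω ∈ B | ∀ i : Fin n, ω i = w i}
  have hdiam : ∀ n w, ∀ ω ∈ {ω ∈ B | ∀ i : Fin n, ω i = w i},
      Metric.ediam (t n w) ≤ ENNReal.ofReal (((p : ℝ)⁻¹) ^ level n ω) := by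
    intro n w ω hω
    refine Metric.ediam_le ?_
    rintro _ ⟨ω₁, h₁, rfl⟩ _ ⟨ω₂, h₂, rfl⟩
    rw [edist_dist, dist_eq_norm]
    have e1 : ∀ i < n, ω₁ i = ω₂ i := fun i hi => (h₁.2 ⟨i, hi⟩).trans (h₂.2 ⟨i, hi⟩).symm
    have e2 : ∀ i < n, ω₁ i = ω i := fun i hi => (h₁.2 ⟨i, hi⟩).trans (hω.2 ⟨i, hi⟩).symm
    rw [← level_congr e2]
    exact ENNReal.ofReal_le_ofReal (norm_codePoint_sub_le e1)
  have hle := Measure.hausdorffMeasure_le_liminf_tsum (s : ℝ) (codePoint '' B) (l := atTop)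
    (fun n : ℕ => ENNReal.ofReal (((p : ℝ)⁻¹) ^ n))
    (by
      rw [← ENNReal.ofReal_zero]
      exact ENNReal.tendsto_ofReal
        (tendsto_pow_atTop_nhds_zero_of_lt_one inv_prime_pos.le inv_prime_lt_one))
    t
    (by
      refine Eventually.of_forall fun n w => ?_
      rcases (({ω ∈ B | ∀ i : Fin n, ω i = w i}).eq_empty_or_nonempty) with he | ⟨ω, hω⟩
      · simp [t, he]
      · refine (hdiam n w ω hω).trans (ENNReal.ofReal_le_ofReal ?_)
        exact pow_le_pow_of_le_one inv_prime_pos.le inv_prime_lt_one.le (le_level n ω))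
    (by
      refine Eventually.of_forall fun n => ?_
      rintro _ ⟨ω, hω, rfl⟩
      exact mem_iUnion.2 ⟨fun i => ω i, ω, ⟨hω, fun i => rfl⟩, rfl⟩)
  have hlim : Tendsto (fun n : ℕ => ∑' w, Metric.ediam (t n w) ^ (s : ℝ)) atTop (𝓝 0) := by
    have h0 : Tendsto (fun n : ℕ => ENNReal.ofReal (Real.exp (-δ) ^ n)) atTop (𝓝 0) := by
      rw [← ENNReal.ofReal_zero]
      exact ENNReal.tendsto_ofReal (tendsto_pow_atTop_nhds_zero_of_lt_one (Real.exp_pos _).le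
        (Real.exp_lt_one_iff.2 (by linarith)))
    refine tendsto_of_tendsto_of_tendsto_of_le_of_le' tendsto_const_nhds h0
      (Eventually.of_forall fun _ => zero_le) ?_
    filter_upwards [eventually_ge_atTop N] with n hn
    calc ∑' w, Metric.ediam (t n w) ^ (s : ℝ)
        ≤ ∑' w : Fin n → ℕ × Fin (p - 1), ENNReal.ofReal (Real.exp (-δ) ^ n) *
            ENNReal.ofReal (∏ i, digitWeight q (w i)) := by
          refine ENNReal.tsum_le_tsum fun w => ?_
          rcases (({ω ∈ B | ∀ i : Fin n, ω i = w i}).eq_empty_or_nonempty) with he | ⟨ω, hω⟩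
          · have : Metric.ediam (t n w) = 0 := by simp [t, he]
            rw [this, ENNReal.zero_rpow_of_pos (by exact_mod_cast hs)]
            exact zero_le
          · refine (ENNReal.rpow_le_rpow (hdiam n w ω hω) s.coe_nonneg).trans ?_
            have hw : ∏ i, digitWeight q (w i) = Real.exp (logMass q n ω) := by
              rw [← prod_digitWeight_eq_exp hq hq1, Finset.prod_range]
              exact Finset.prod_congr rfl fun i _ => by rw [hω.2 i]
            rw [hw, ENNReal.ofReal_rpow_of_nonneg (pow_nonneg inv_prime_pos.le _) s.coe_nonneg,
              ← exp_neg_mul_log_mul_level, ← ENNReal.ofReal_mul (pow_nonneg (Real.exp_pos _).le _),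
              ← Real.exp_nat_mul, ← Real.exp_add]
            refine ENNReal.ofReal_le_ofReal (Real.exp_le_exp.2 ?_)
            have := hB ω hω.1 n hn
            linarith
      _ = ENNReal.ofReal (Real.exp (-δ) ^ n) := by
          rw [ENNReal.tsum_mul_left, tsum_prod_digitWeight hq, mul_one]
  rw [hlim.liminf_eq] at hle
  exact (hle.trans_lt ENNReal.zero_lt_top).ne

lemma dimH_le_of_pos {q : unitInterval} (hq : q ≠ 0) (hq1 : q ≠ 1) {s : ℝ≥0} (hs : 0 < s) {l : ℝ}
    (h : 0 < Real.log (q / ((p : ℝ) - 1)) + (l - 1) * Real.log (1 - q) + s * Real.log p * l) :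
    dimH (approximationLevelSet p (l * Real.log p)) ≤ s := by
  set c := Real.log (q / ((p : ℝ) - 1)) + (l - 1) * Real.log (1 - q) + s * Real.log p * l
  let B : ℕ → Set (ℕ → ℕ × Fin (p - 1)) := fun N =>
    {ω | ∀ n ≥ N, n * (c / 2) ≤ logMass q n ω + s * Real.log p * level n ω}
  have hsub : approximationLevelSet p (l * Real.log p) ⊆ ⋃ N, codePoint '' B N := by
    rw [approximationLevelSet_eq_image]
    rintro _ ⟨ω, hω, rfl⟩
    have h1 := (tendsto_logMass_add_div q s 0 hω).eventually_const_lt (half_lt_self h)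
    obtain ⟨N, hN⟩ := eventually_atTop.1 (h1.and (eventually_gt_atTop 0))
    refine mem_iUnion.2 ⟨N, ω, fun n hn => ?_, rfl⟩
    obtain ⟨h2, h3⟩ := hN n hn
    rw [lt_div_iff₀ (by exact_mod_cast h3)] at h2
    rw [mul_comm]
    exact h2.le
  refine (dimH_mono hsub).trans ?_
  rw [dimH_iUnion]
  exact iSup_le fun N => dimH_image_codePoint_le hq hq1 hs (half_pos h) fun ω hω => hω

/-! ### The lower bound for the dimension -/

/-- The points `ω` whose cylinders of depth `n` have mass at most `p ^ (-s (a₁ + ⋯ + aₙ₊₁))`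
once `a₁ + ⋯ + aₙ₊₁ ≥ N`. -/
def frostmanSet (q : unitInterval) (s : ℝ) (N : ℕ) : Set (ℕ → ℕ × Fin (p - 1)) :=
  {ω | ∀ n, N ≤ level (n + 1) ω →
    sequenceLaw p q {ω' | ∀ i < n, ω i = ω' i} ≤
      ENNReal.ofReal ((((p : ℝ)⁻¹) ^ level (n + 1) ω) ^ s)}

/-- The mass of a ball of radius `r` is at most that of the deepest cylinder containing it, whose
successor has diameter of order at most `r`. -/
lemma sequenceLaw_ball_le {q : unitInterval} {s : ℝ} (hs : 0 ≤ s) {N : ℕ}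
    {ω : ℕ → ℕ × Fin (p - 1)} (hω : ω ∈ frostmanSet q s N) {r : ℝ} (hr : 0 < r)
    (hrN : r ≤ ((p : ℝ)⁻¹) ^ N) (hr1 : r < 1) :
    sequenceLaw p q {ω' | ‖codePoint ω - codePoint ω'‖ ≤ r} ≤ ENNReal.ofReal (r ^ s) := by
  classical
  have hex : ∃ n, ((p : ℝ)⁻¹) ^ level n ω ≤ r := by
    obtain ⟨n, hn⟩ := exists_pow_lt_of_lt_one hr (inv_prime_lt_one (p := p))
    exact ⟨n, (pow_le_pow_of_le_one inv_prime_pos.le inv_prime_lt_one.le (le_level n ω)).trans hn.le⟩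
  obtain ⟨n, hn⟩ : ∃ n, Nat.find hex = n + 1 := by
    refine Nat.exists_eq_succ_of_ne_zero fun h0 => ?_
    have := Nat.find_spec hex
    rw [h0, level, Finset.sum_range_zero, pow_zero] at this
    exact hr1.not_ge this
  have h1 : ((p : ℝ)⁻¹) ^ level (n + 1) ω ≤ r := hn ▸ Nat.find_spec hex
  have h2 : r < ((p : ℝ)⁻¹) ^ level n ω := not_le.1 (Nat.find_min hex (by omega))
  have h3 : N ≤ level (n + 1) ω :=
    (pow_le_pow_iff_right_of_lt_one₀ inv_prime_pos inv_prime_lt_one).1 (h1.trans hrN)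
  calc sequenceLaw p q {ω' | ‖codePoint ω - codePoint ω'‖ ≤ r}
      ≤ sequenceLaw p q {ω' | ∀ i < n, ω i = ω' i} :=
        measure_mono fun ω' h => eq_of_norm_codePoint_sub_lt (lt_of_le_of_lt h h2)
    _ ≤ ENNReal.ofReal ((((p : ℝ)⁻¹) ^ level (n + 1) ω) ^ s) := hω n h3
    _ ≤ ENNReal.ofReal (r ^ s) := ENNReal.ofReal_le_ofReal
        (Real.rpow_le_rpow (pow_nonneg inv_prime_pos.le _) h1 hs)

/-- The mass distribution principle for the image of `sequenceLaw p q` restricted to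
`frostmanSet q s N`. -/
lemma le_dimH_image_codePoint {q : unitInterval} {s : ℝ≥0} {N : ℕ}
    {A : Set (ℕ → ℕ × Fin (p - 1))} (hA : sequenceLaw p q (A ∩ frostmanSet q s N) ≠ 0) :
    s ≤ dimH (codePoint '' A) := by
  borelize ℚ_[p]
  have hmeas : Measurable (codePoint (p := p)) := continuous_codePoint.measurable
  set P := sequenceLaw p q
  set ν : Measure ℚ_[p] := (P.restrict (frostmanSet q s N)).map codePoint with hν
  set r₀ : ℝ := ((p : ℝ)⁻¹) ^ (N + 1) with hr₀
  have hr₀pos : 0 < r₀ := pow_pos inv_prime_pos _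
  have hr₀N : r₀ ≤ ((p : ℝ)⁻¹) ^ N :=
    pow_le_pow_of_le_one inv_prime_pos.le inv_prime_lt_one.le (Nat.le_succ N)
  have hr₀1 : r₀ < 1 := pow_lt_one₀ inv_prime_pos.le inv_prime_lt_one (Nat.succ_ne_zero N)
  have hle : ν ≤ Measure.hausdorffMeasure (s : ℝ) := by
    refine Measure.le_hausdorffMeasure _ _ (ENNReal.ofReal (r₀ / 2))
      (ENNReal.ofReal_pos.2 (half_pos hr₀pos)) fun u hu => ?_
    have hν_apply : ν (closure u) = P (codePoint ⁻¹' closure u ∩ frostmanSet q s N) := by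
      rw [hν, Measure.map_apply hmeas isClosed_closure.measurableSet,
        Measure.restrict_apply (hmeas isClosed_closure.measurableSet)]
    refine (measure_mono subset_closure).trans ?_
    rw [hν_apply]
    rcases (codePoint ⁻¹' closure u ∩ frostmanSet q s N).eq_empty_or_nonempty with he | ⟨ω, hω⟩
    · rw [he, measure_empty]
      exact zero_le
    have htop : Metric.ediam u ≠ ∞ := (hu.trans_lt ENNReal.ofReal_lt_top).ne
    set d : ℝ := (Metric.ediam u).toReal with hd
    have hd0 : 0 ≤ d := ENNReal.toReal_nonneg
    have hd1 : d ≤ r₀ / 2 := ENNReal.toReal_le_of_le_ofReal (half_pos hr₀pos).le hu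
    have hsub : ∀ ω' ∈ codePoint ⁻¹' closure u, ‖codePoint ω - codePoint ω'‖ ≤ d := by
      intro ω' hω'
      rw [← dist_eq_norm, dist_edist, hd, ← Metric.ediam_closure]
      refine ENNReal.toReal_mono (by rwa [Metric.ediam_closure]) ?_
      exact Metric.edist_le_ediam_of_mem hω.1 hω'
    -- Any radius `r > d` is admissible, which also covers `d = 0`, where `u` is a point.
    have hbound : ∀ᶠ r in 𝓝[>] d, P (codePoint ⁻¹' closure u ∩ frostmanSet q s N) ≤
        ENNReal.ofReal (r ^ (s : ℝ)) := by
      filter_upwards [Ioo_mem_nhdsGT (show d < r₀ by linarith)] with r hr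
      refine (measure_mono fun ω' hω' => ?_).trans (sequenceLaw_ball_le s.coe_nonneg hω.2
        (hd0.trans_lt hr.1) (hr.2.le.trans hr₀N) (hr.2.trans hr₀1))
      exact (hsub ω' hω'.1).trans hr.1.le
    have hcont : Tendsto (fun r : ℝ => ENNReal.ofReal (r ^ (s : ℝ))) (𝓝[>] d)
        (𝓝 (ENNReal.ofReal (d ^ (s : ℝ)))) :=
      ENNReal.tendsto_ofReal
        ((Real.continuous_rpow_const s.coe_nonneg).continuousAt.tendsto.mono_left nhdsWithin_le_nhds)
    have := ge_of_tendsto hcont hbound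
    rwa [← ENNReal.ofReal_rpow_of_nonneg hd0 s.coe_nonneg, hd, ENNReal.ofReal_toReal htop] at this
  refine le_dimH_of_hausdorffMeasure_ne_zero fun h0 => hA ?_
  have h1 : ν (codePoint '' A) = 0 := le_antisymm ((hle _).trans h0.le) zero_le
  have h2 := (Measure.le_map_apply hmeas.aemeasurable (codePoint '' A)).trans h1.le
  refine le_antisymm (((measure_mono ?_).trans (Measure.le_restrict_apply _ _)).trans h2) zero_le
  exact inter_subset_inter_left _ (subset_preimage_image _ _)

lemma le_dimH_of_neg {q : unitInterval} (hq : q ≠ 0) {s : ℝ≥0}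
    (h : Real.log (q / ((p : ℝ) - 1)) + ((q : ℝ)⁻¹ - 1) * Real.log (1 - q) +
      s * Real.log p * (q : ℝ)⁻¹ < 0) :
    s ≤ dimH (approximationLevelSet p ((q : ℝ)⁻¹ * Real.log p)) := by
  rw [approximationLevelSet_eq_image]
  set A := {ω : ℕ → ℕ × Fin (p - 1) |
    Tendsto (fun n : ℕ => (level n ω : ℝ) / n) atTop (𝓝 ((q : ℝ)⁻¹))} with hA
  have hsub : A ⊆ ⋃ N, A ∩ frostmanSet q s N := by
    intro ω hω
    have h1 := (tendsto_logMass_add_div q s 1 hω).eventually_lt_const h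
    obtain ⟨n₀, hn₀⟩ := eventually_atTop.1 (h1.and (eventually_gt_atTop 0))
    refine mem_iUnion.2 ⟨level n₀ ω + 1, hω, fun n hn => ?_⟩
    have hn' : n₀ ≤ n := by
      by_contra! hlt
      have := level_mono ω hlt
      simp only [Nat.succ_eq_add_one] at this
      omega
    obtain ⟨h2, h3⟩ := hn₀ n hn'
    rw [div_lt_iff₀ (by exact_mod_cast h3), zero_mul] at h2
    rw [sequenceLaw_cylinder hq, ← exp_neg_mul_log_mul_level]
    refine ENNReal.ofReal_le_ofReal ((prod_digitWeight_le_exp hq n ω).trans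
      (Real.exp_le_exp.2 ?_))
    linarith
  have hfull : sequenceLaw p q A ≠ 0 := by
    rw [(prob_compl_eq_zero_iff₀ ?_).1 (ae_tendsto_level_div hq)]
    · exact one_ne_zero
    · exact NullMeasurableSet.of_compl (NullMeasurableSet.of_null (ae_tendsto_level_div hq))
  obtain ⟨N, hN⟩ : ∃ N, sequenceLaw p q (A ∩ frostmanSet q s N) ≠ 0 := by
    by_contra! hzero
    exact hfull (measure_mono_null hsub (measure_iUnion_null hzero))
  exact le_dimH_image_codePoint hN

/-! ### Evaluation of the dimension -/

lemma toReal_eq_of_forall_nnreal {d : ℝ≥0∞} {D : ℝ} (hD : 0 ≤ D)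
    (h1 : ∀ s : ℝ≥0, D < s → d ≤ s) (h2 : ∀ s : ℝ≥0, (s : ℝ) < D → s ≤ d) :
    d ≠ ∞ ∧ d.toReal = D := by
  lift D to ℝ≥0 using hD
  have : d = D := by
    refine le_antisymm (ENNReal.le_of_forall_pos_le_add fun ε hε _ => ?_)
      (ENNReal.le_of_forall_nnreal_lt fun s hs => h2 s (by exact_mod_cast hs))
    have := h1 (D + ε) (by exact_mod_cast lt_add_of_pos_right D hε)
    exact_mod_cast this
  rw [this]
  exact ⟨ENNReal.coe_ne_top, rfl⟩

lemma log_prime_pos : 0 < Real.log p := Real.log_pos (by exact_mod_cast hp.out.one_lt)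

lemma log_sub_one_nonneg : 0 ≤ Real.log ((p : ℝ) - 1) := by
  have : (2 : ℝ) ≤ p := by exact_mod_cast hp.out.two_le
  exact Real.log_nonneg (by linarith)

/-- The dimension is the entropy `log (p - 1) + l log l - (l - 1) log (l - 1)` of the law of one
digit pair with mean exponent `l`, divided by the Lyapunov exponent
`l * log p`. -/
theorem dimH_approximationLevelSet_mul_log {l : ℝ} (hl : 1 < l) :
    dimH (approximationLevelSet p (l * Real.log p)) ≠ ∞ ∧
      (dimH (approximationLevelSet p (l * Real.log p))).toReal =
        (Real.log ((p : ℝ) - 1) + l * Real.log l - (l - 1) * Real.log (l - 1)) /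
          (l * Real.log p) := by
  have hl0 : 0 < l := zero_lt_one.trans hl
  have hl1 : 0 < l - 1 := sub_pos.2 hl
  have hL := log_prime_pos (p := p)
  -- The success probability for which the exponents have mean `l`.
  let q : unitInterval := ⟨l⁻¹, (inv_pos.2 hl0).le, inv_le_one_of_one_le₀ hl.le⟩
  have hqv : (q : ℝ) = l⁻¹ := rfl
  have hq : q ≠ 0 := by
    rw [← unitInterval.coe_ne_zero, hqv]
    exact (inv_pos.2 hl0).ne'
  have hq1 : q ≠ 1 := by
    rw [← unitInterval.coe_ne_one, hqv]
    exact (inv_lt_one_of_one_lt₀ hl).ne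
  have hlog1 : Real.log (q / ((p : ℝ) - 1)) = -Real.log l - Real.log ((p : ℝ) - 1) := by
    rw [hqv, Real.log_div (inv_pos.2 hl0).ne' sub_one_pos.ne', Real.log_inv]
  have hlog2 : Real.log (1 - q) = Real.log (l - 1) - Real.log l := by
    rw [hqv, ← Real.log_div hl1.ne' hl0.ne']
    congr 1
    field_simp
  have hpos : 0 < l * Real.log p := mul_pos hl0 hL
  have hnn : 0 ≤ Real.log ((p : ℝ) - 1) + l * Real.log l - (l - 1) * Real.log (l - 1) := by
    have h1 := log_sub_one_nonneg (p := p)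
    have h2 := Real.log_pos hl
    have h3 : Real.log (l - 1) ≤ Real.log l := Real.log_le_log hl1 (by linarith)
    linarith [mul_le_mul_of_nonneg_left h3 hl1.le]
  refine toReal_eq_of_forall_nnreal (div_nonneg hnn hpos.le) (fun s hs => ?_) fun s hs => ?_
  · rw [div_lt_iff₀ hpos] at hs
    have hs0 : 0 < s := by
      have := pos_of_mul_pos_left (hnn.trans_lt hs) hpos.le
      exact_mod_cast this
    refine dimH_le_of_pos hq hq1 hs0 ?_
    rw [hlog1, hlog2]
    linarith
  · rw [lt_div_iff₀ hpos] at hs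
    have := le_dimH_of_neg (p := p) hq (s := s) (by
      rw [hlog1, hlog2, hqv, inv_inv]
      linarith)
    rwa [hqv, inv_inv] at this

theorem dimH_approximationLevelSet_log :
    dimH (approximationLevelSet p (Real.log p)) ≠ ∞ ∧
      (dimH (approximationLevelSet p (Real.log p))).toReal =
        Real.log ((p : ℝ) - 1) / Real.log p := by
  have hL := log_prime_pos (p := p)
  have h0 := log_sub_one_nonneg (p := p)
  refine toReal_eq_of_forall_nnreal (div_nonneg h0 hL.le) (fun s hs => ?_) fun s hs => ?_
  · rw [div_lt_iff₀ hL] at hs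
    have hs0 : 0 < s := by
      have := pos_of_mul_pos_left (h0.trans_lt hs) hL.le
      exact_mod_cast this
    -- For `q = 1` most cylinders have mass zero and `dimH_le_of_pos` fails, so `q` is taken below
    -- `1`, but so close to `1` that the loss `-log q = η / 2` is affordable.
    set η := s * Real.log p - Real.log ((p : ℝ) - 1) with hη
    have hηpos : 0 < η := sub_pos.2 hs
    have hlt : Real.exp (-(η / 2)) < 1 := Real.exp_lt_one_iff.2 (by linarith)
    let q : unitInterval := ⟨Real.exp (-(η / 2)), (Real.exp_pos _).le, hlt.le⟩
    have hqv : (q : ℝ) = Real.exp (-(η / 2)) := rfl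
    have hq : q ≠ 0 := by
      rw [← unitInterval.coe_ne_zero, hqv]
      exact (Real.exp_pos _).ne'
    have hq1 : q ≠ 1 := by
      rw [← unitInterval.coe_ne_one, hqv]
      exact hlt.ne
    have := dimH_le_of_pos (p := p) (l := 1) hq hq1 hs0 (by
      rw [hqv, Real.log_div (Real.exp_pos _).ne' sub_one_pos.ne', Real.log_exp]
      linarith)
    rwa [one_mul] at this
  · rw [lt_div_iff₀ hL] at hs
    have := le_dimH_of_neg (p := p) (q := 1) one_ne_zero (s := s) (by
      simp only [Set.Icc.coe_one, Real.log_div one_ne_zero sub_one_pos.ne', Real.log_one]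
      simp only [inv_one, sub_self, zero_mul]
      linarith)
    simpa using this

end Schneider

theorem corollary1p3 (p : ℕ) [Fact p.Prime] :
    (∀ α : ℝ, Real.log p < α →
      dimH (Schneider.approximationLevelSet p α) ≠ ⊤ ∧
      (dimH (Schneider.approximationLevelSet p α)).toReal =
        (Real.log ((p : ℝ) - 1) + Real.log (α - Real.log p) - Real.log (Real.log p)
          + α * Real.logb p α - α * Real.logb p (α - Real.log p)) / α) ∧
    (dimH (Schneider.approximationLevelSet p (Real.log p)) ≠ ⊤ ∧
      (dimH (Schneider.approximationLevelSet p (Real.log p))).toReal =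
        Real.log ((p : ℝ) - 1) / Real.log p) := by
  refine ⟨fun α hα => ?_, Schneider.dimH_approximationLevelSet_log⟩
  have hL := Schneider.log_prime_pos (p := p)
  have hl : 1 < α / Real.log p := (one_lt_div hL).2 hα
  have h := Schneider.dimH_approximationLevelSet_mul_log (p := p) hl
  rw [div_mul_cancel₀ _ hL.ne'] at h
  refine ⟨h.1, h.2.trans ?_⟩
  have h1 : α / Real.log p - 1 = (α - Real.log p) / Real.log p := by field_simp
  rw [h1, Real.log_div (hL.trans hα).ne' hL.ne', Real.log_div (sub_pos.2 hα).ne' hL.ne',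
    Real.logb, Real.logb]
  congr 1
  field_simp
  ring
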